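/- Let $\mathbb F_2^{\mathbb N}$ be the space of infinite binary sequences; for such a sequence $x$ let $x[:n]$ be its prefix of length $n$, and let $d_H$ denote Hamming distance. For real $R>0$ and $\varepsilon>0$, a function $C:\mathbb F_2^{\mathbb N}\to\mathbb F_2^{\mathbb N}$ is called a binary $(R,\varepsilon)$-unbounded code if there exists $k_0\in\mathbb N$ such that for all $x,y\in\mathbb F_2^{\mathbb N}$ and all integers $i\ge k_0$ and $j\ge i/R$, $$x[:i]\ne y[:i]\ \Longrightarrow\ d_H\bigl(C(x)[:j],\,C(y)[:j]\bigr)\ge \varepsilon j .$$ The code is called linear if $C$ is an $\mathbb F_2$-linear map. **Theorem.** (1) There is a universal constant $c>0$ such that for all $R>0$ and $\varepsilon>0$, if a binary $(R,\varepsilon)$-unbounded code exists, then $R\le 1-c\sqrt{\varepsilon}$. (2) There is a universal constant $c>0$ such that for all $R>0$ and $0<\varepsilon<1$, if a linear binary $(R,\varepsilon)$-unbounded code exists, then $R\le 1-c\sqrt{\varepsilon\log_2(1/\varepsilon)}$. -/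

import Mathlib

/-- The finite word consisting of the first `n` symbols of the infinite word `x`. -/
def initSeg {α : Type*} (x : ℕ → α) (n : ℕ) : Fin n → α := fun t => x t

/-- `C` is an `(R, ε)`-unbounded code: from some `k₀` on, any two messages that differ within
their first `i` symbols have codewords whose first `j` symbols are at Hamming distance at least
`ε j`, for all `j ≥ i / R`. It is meant for rates `R > 0`. -/
def IsUnboundedCode {α β : Type*} [DecidableEq β] (R ε : ℝ) (C : (ℕ → α) → (ℕ → β)) : Prop :=
  ∃ k₀ : ℕ, ∀ (x y : ℕ → α) (i j : ℕ), k₀ ≤ i → (i : ℝ) / R ≤ (j : ℝ) →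
    initSeg x i ≠ initSeg y i →
      ε * (j : ℝ) ≤ (hammingDist (initSeg (C x) j) (initSeg (C y) j) : ℝ)

/-!
Why the rate is bounded. Let `R ≥ 1 - δ` with `δ > 0`, take `M` of order `1 / δ`, and cut the codeword
positions `4 M q, …, 8 M q` into `M` windows of length `4 q`. At the end `t` of a window the code determines
the first `t - q` message symbols, with distance at least `4 ε M q`.

*Few prefixes per message.* Since the message prefix of length `t - q` is decodable from the code
prefix of length `t`, a message prefix `u` of that length has on average at most `2 ^ q` code
prefixes, and only a `2 ^ (-q)` fraction has more than `2 ^ (2 q)`. So half of all messages are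
sparse (`IsSparse`) at every window (`pow_le_two_mul_card_sparse`).

*Loss per window.* Fix the code prefix `p` before a window. For each `u` let `B_u` be the set of
words seen in the window. For different `u` these sets are at distance more than `2 r`, where `r` is
of order `ε M q`, because the codewords agree on `p`; so their `r`-thickenings are disjoint in the
cube of dimension `4 q`. If thickening multiplies the size of every set `B_u` with at most
`2 ^ (2 q)` elements by at least `G`, then `p` has at most `2 ^ (4 q) / G` continuations by
sparse messages (`mul_card_continuations_le`). Over `M` windows this leaves at most
`2 ^ (8 M q) / G ^ M` code prefixes for at least `2 ^ (8 M q - q) / 2` messages, so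
`G ^ M ≤ 2 ^ (q + 1)` (`pow_le_of_growth`).

*Growth.* For arbitrary sets the edge-isoperimetric inequality of the cube (`internalDegree_le`)
gives a factor `5 / 4` per unit of radius, so that `log G` is of order `ε M q`, and
`M ^ 2 ε = O(1)`: the gap `δ` is at least of order `√ε`. For a linear code the sets `B_u` are
affine subspaces, and some `2 q` coordinates support no nonzero direction vector. Adding the words
of weight `r` on these coordinates gives `G = choose (2 q) r`, which gains a factor of order
`log (1 / ε)` in the exponent.
-/

/-! ### Expansion of subsets of the Hamming cube -/

/-- The set of words at Hamming distance at most `r` from some word of `B`. -/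
def hammingThickening {n : ℕ} (B : Finset (Fin n → ZMod 2)) (r : ℕ) : Finset (Fin n → ZMod 2) :=
  Finset.univ.filter fun y => ∃ b ∈ B, hammingDist b y ≤ r

theorem mem_hammingThickening {n : ℕ} {B : Finset (Fin n → ZMod 2)} {r : ℕ}
    {y : Fin n → ZMod 2} : y ∈ hammingThickening B r ↔ ∃ b ∈ B, hammingDist b y ≤ r := by
  simp [hammingThickening]

theorem subset_hammingThickening {n : ℕ} (B : Finset (Fin n → ZMod 2)) (r : ℕ) :
    B ⊆ hammingThickening B r :=
  fun b hb => mem_hammingThickening.2 ⟨b, hb, by simp⟩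

theorem hammingThickening_one_subset {n : ℕ} (B : Finset (Fin n → ZMod 2)) (r : ℕ) :
    hammingThickening (hammingThickening B r) 1 ⊆ hammingThickening B (r + 1) := by
  intro y hy
  obtain ⟨z, hz, hzy⟩ := mem_hammingThickening.1 hy
  obtain ⟨b, hb, hbz⟩ := mem_hammingThickening.1 hz
  exact mem_hammingThickening.2 ⟨b, hb, (hammingDist_triangle b z y).trans (by omega)⟩

/-- The word `x` with its `i`-th bit flipped. -/
def bitFlip {n : ℕ} (x : Fin n → ZMod 2) (i : Fin n) : Fin n → ZMod 2 :=
  Function.update x i (x i + 1)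

theorem bitFlip_bitFlip {n : ℕ} (x : Fin n → ZMod 2) (i : Fin n) :
    bitFlip (bitFlip x i) i = x := by
  have h : (1 : ZMod 2) + 1 = 0 := by decide
  simp [bitFlip, add_assoc, h]

theorem hammingDist_bitFlip_le {n : ℕ} (x : Fin n → ZMod 2) (i : Fin n) :
    hammingDist x (bitFlip x i) ≤ 1 := by
  refine (Finset.card_le_card (t := {i}) ?_).trans (by simp)
  intro j hj
  by_contra hji
  have hne : j ≠ i := by simpa using hji
  exact (Finset.mem_filter.1 hj).2 (by simp [bitFlip, hne])

/-- The number of ordered pairs of adjacent vertices of the cube inside `A`. -/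
def internalDegree {n : ℕ} (A : Finset (Fin n → ZMod 2)) : ℕ :=
  ∑ x, ∑ i, if x ∈ A ∧ bitFlip x i ∈ A then 1 else 0

/-- The half of `A` whose first bit is `a`, with that bit removed. -/
def cubeSection {n : ℕ} (A : Finset (Fin (n + 1) → ZMod 2)) (a : ZMod 2) :
    Finset (Fin n → ZMod 2) :=
  Finset.univ.filter fun y => (Fin.cons a y : Fin (n + 1) → ZMod 2) ∈ A

theorem sum_cube_succ {n : ℕ} (f : (Fin (n + 1) → ZMod 2) → ℕ) :
    ∑ x, f x = ∑ y : Fin n → ZMod 2, f (Fin.cons 0 y) + ∑ y : Fin n → ZMod 2, f (Fin.cons 1 y) := by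
  rw [← (Fin.consEquiv fun _ => ZMod 2).sum_comp, Fintype.sum_prod_type]
  exact Fin.sum_univ_two _

theorem card_cubeSection {n : ℕ} (A : Finset (Fin (n + 1) → ZMod 2)) :
    A.card = (cubeSection A 0).card + (cubeSection A 1).card := by
  have h := sum_cube_succ fun x => if x ∈ A then 1 else 0
  simpa [cubeSection] using h

theorem internalDegree_succ {n : ℕ} (A : Finset (Fin (n + 1) → ZMod 2)) :
    internalDegree A = internalDegree (cubeSection A 0) + internalDegree (cubeSection A 1)
      + 2 * (cubeSection A 0 ∩ cubeSection A 1).card := by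
  have h0 : ∀ (a : ZMod 2) (y : Fin n → ZMod 2),
      bitFlip (Fin.cons a y : Fin (n + 1) → ZMod 2) 0 = Fin.cons (a + 1) y := by
    intro a y; simp [bitFlip]
  have hs : ∀ (a : ZMod 2) (y : Fin n → ZMod 2) (i : Fin n),
      bitFlip (Fin.cons a y : Fin (n + 1) → ZMod 2) i.succ = Fin.cons a (bitFlip y i) := by
    intro a y i; simp [bitFlip]
  have h11 : (1 : ZMod 2) + 1 = 0 := by decide
  have hc : (cubeSection A 0 ∩ cubeSection A 1).card
      = ∑ y, if (Fin.cons 0 y : Fin (n + 1) → ZMod 2) ∈ A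
          ∧ (Fin.cons 1 y : Fin (n + 1) → ZMod 2) ∈ A then 1 else 0 := by
    rw [Finset.sum_boole, Nat.cast_id]
    congr 1
    ext y
    simp [cubeSection]
  unfold internalDegree
  rw [sum_cube_succ]
  simp only [Fin.sum_univ_succ, h0, hs, Finset.sum_add_distrib, h11, zero_add, hc]
  simp only [cubeSection, Finset.mem_filter, Finset.mem_univ, true_and]
  simp only [and_comm (a := (Fin.cons 1 _ : Fin (n + 1) → ZMod 2) ∈ A)
    (b := (Fin.cons 0 _ : Fin (n + 1) → ZMod 2) ∈ A)]
  ring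

/-- The numerical inequality behind the edge-isoperimetric inequality: the entropy of a split of
`a + b` points into `a` and `b` is at least `2 b`. -/
theorem mul_logb_add_le {a b : ℝ} (hb : 0 ≤ b) (hab : b ≤ a) :
    a * Real.logb 2 a + b * Real.logb 2 b + 2 * b ≤ (a + b) * Real.logb 2 (a + b) := by
  rcases hb.eq_or_lt with rfl | hb
  · simp
  have ha : 0 < a := hb.trans_le hab
  have h1 : Real.logb 2 b + 1 ≤ Real.logb 2 (a + b) := by
    rw [← Real.logb_self_eq_one one_lt_two, ← Real.logb_mul hb.ne' two_ne_zero]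
    exact Real.logb_le_logb_of_le one_lt_two (by positivity) (by linarith)
  have h2 : Real.logb 2 a + b / a ≤ Real.logb 2 (a + b) := by
    have h : (1 + 1 : ℝ) ^ (b / a) ≤ 1 + b / a * 1 :=
      rpow_one_add_le_one_add_mul_self (by norm_num) (by positivity)
        ((div_le_one ha).2 hab)
    rw [← Real.logb_rpow (b := 2) (x := b / a) two_pos (by norm_num),
      ← Real.logb_mul ha.ne' (by positivity)]
    refine Real.logb_le_logb_of_le one_lt_two (by positivity) ?_
    norm_num at h
    calc a * 2 ^ (b / a) ≤ a * (1 + b / a) := by gcongr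
      _ = a + b := by field_simp
  have h3 := mul_le_mul_of_nonneg_left h2 ha.le
  have h4 := mul_le_mul_of_nonneg_left h1 hb.le
  have h5 : a * (b / a) = b := by field_simp
  nlinarith

/-- Edge-isoperimetric inequality of the cube: a set of `m` vertices has average internal degree
at most `log₂ m`. -/
theorem internalDegree_le {n : ℕ} (A : Finset (Fin n → ZMod 2)) :
    (internalDegree A : ℝ) ≤ A.card * Real.logb 2 A.card := by
  induction n with
  | zero =>
    have : 0 ≤ (A.card : ℝ) * Real.logb 2 A.card := by
      rcases Nat.eq_zero_or_pos A.card with h | h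
      · simp [h]
      · exact mul_nonneg (by positivity) (Real.logb_nonneg one_lt_two (by exact_mod_cast h))
    simpa [internalDegree] using this
  | succ n ih =>
    rw [internalDegree_succ, card_cubeSection]
    have h0 := ih (cubeSection A 0)
    have h1 := ih (cubeSection A 1)
    have i0 : ((cubeSection A 0 ∩ cubeSection A 1).card : ℝ) ≤ (cubeSection A 0).card := by
      exact_mod_cast Finset.card_le_card Finset.inter_subset_left
    have i1 : ((cubeSection A 0 ∩ cubeSection A 1).card : ℝ) ≤ (cubeSection A 1).card := by
      exact_mod_cast Finset.card_le_card Finset.inter_subset_right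
    push_cast
    rcases le_total ((cubeSection A 0).card : ℝ) (cubeSection A 1).card with h | h
    · have := mul_logb_add_le (by positivity) h
      rw [add_comm ((cubeSection A 0).card : ℝ)]
      linarith
    · have := mul_logb_add_le (by positivity) h
      linarith

/-- Vertex expansion. At least `|A| (n - log₂ |A|)` edges leave `A`, and each new vertex absorbs at
most `n` of them. -/
theorem card_mul_le_card_hammingThickening_one {n : ℕ} (A : Finset (Fin n → ZMod 2)) :
    (A.card : ℝ) * (n - Real.logb 2 A.card)
      ≤ n * ((hammingThickening A 1).card - A.card) := by
  classical
  set E := (A ×ˢ (Finset.univ : Finset (Fin n))).filter fun e => bitFlip e.1 e.2 ∉ A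
  have hE : internalDegree A + E.card = A.card * n := by
    have h1 : internalDegree A
        = ((A ×ˢ (Finset.univ : Finset (Fin n))).filter fun e => bitFlip e.1 e.2 ∈ A).card := by
      rw [Finset.card_filter, Finset.sum_product, internalDegree]
      simp only [ite_and]
      rw [← Finset.sum_subset (Finset.subset_univ A)]
      · exact Finset.sum_congr rfl fun x hx => by simp [hx]
      · intro x _ hx; simp [hx]
    rw [h1, Finset.card_filter_add_card_filter_not]
    simp
  have hmap : E.card ≤ ((hammingThickening A 1 \ A) ×ˢ (Finset.univ : Finset (Fin n))).card := by
    refine Finset.card_le_card_of_injOn (fun e => (bitFlip e.1 e.2, e.2)) ?_ ?_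
    · rintro ⟨x, i⟩ he
      simp only [E, Finset.coe_filter, Finset.mem_product, Finset.mem_univ, and_true,
        Set.mem_ofPred_eq] at he
      simp only [Finset.coe_product, Set.mem_prod, Finset.mem_coe, Finset.mem_sdiff,
        Finset.mem_univ, and_true]
      exact ⟨mem_hammingThickening.2 ⟨x, he.1, hammingDist_bitFlip_le x i⟩, he.2⟩
    · rintro ⟨x, i⟩ _ ⟨y, j⟩ _ h
      simp only [Prod.mk.injEq] at h
      obtain ⟨h, rfl⟩ := h
      have := congrArg (fun z => bitFlip z i) h
      simp only [bitFlip_bitFlip] at this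
      rw [this]
  rw [Finset.card_product, Finset.card_sdiff_of_subset (subset_hammingThickening A 1),
    Finset.card_univ, Fintype.card_fin] at hmap
  have hle := Finset.card_le_card (subset_hammingThickening A 1)
  have hm : (E.card : ℝ) ≤ ((hammingThickening A 1).card - A.card) * n := by
    rw [← Nat.cast_sub hle]; exact_mod_cast hmap
  have hE' : (internalDegree A : ℝ) + E.card = A.card * n := by exact_mod_cast hE
  have := internalDegree_le A
  nlinarith

/-- A set of at most `2 ^ (2 q)` words of length `4 q` grows by a factor `5 / 4` with every unit
of radius, as long as `2 ^ (3 q)` words cannot yet have been reached. -/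
theorem pow_mul_card_le_card_hammingThickening {q r : ℕ} (hq : 0 < q)
    (hr : (5 / 4 : ℝ) ^ r ≤ 2 ^ q) (B : Finset (Fin (4 * q) → ZMod 2))
    (hB : B.card ≤ 2 ^ (2 * q)) :
    (5 / 4 : ℝ) ^ r * B.card ≤ (hammingThickening B r).card := by
  induction r with
  | zero =>
    simpa using Finset.card_le_card (subset_hammingThickening B 0)
  | succ r ih =>
    have hBr : (B.card : ℝ) ≤ 2 ^ (2 * q) := by exact_mod_cast hB
    have hle : (5 / 4 : ℝ) ^ r ≤ 2 ^ q :=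
      (pow_le_pow_right₀ (by norm_num) (Nat.le_succ r)).trans hr
    specialize ih hle
    set A := hammingThickening B r
    have hsub : ((hammingThickening A 1).card : ℝ) ≤ (hammingThickening B (r + 1)).card := by
      exact_mod_cast Finset.card_le_card (hammingThickening_one_subset B r)
    by_cases hA : A.card ≤ 2 ^ (3 * q)
    · rcases Nat.eq_zero_or_pos A.card with h0 | h0
      · have : (B.card : ℝ) = 0 := by
          have := Finset.card_le_card (subset_hammingThickening B r)
          have : B.card = 0 := by simp only [A] at h0; omega
          exact_mod_cast this
        rw [this]; simp
      have hlog : Real.logb 2 A.card ≤ 3 * q := by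
        rw [Real.logb_le_iff_le_rpow one_lt_two (by exact_mod_cast h0)]
        have : (A.card : ℝ) ≤ 2 ^ (3 * q) := by exact_mod_cast hA
        calc (A.card : ℝ) ≤ 2 ^ (3 * q) := this
          _ = (2 : ℝ) ^ (3 * q : ℝ) := by rw [← Real.rpow_natCast]; push_cast; rfl
      have h := card_mul_le_card_hammingThickening_one A
      push_cast at h
      have hq' : (0 : ℝ) < q := by exact_mod_cast hq
      have h2 : (A.card : ℝ) * q ≤ 4 * q * ((hammingThickening A 1).card - A.card) :=
        le_trans (mul_le_mul_of_nonneg_left (by linarith) (by positivity)) h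
      have h3 : (A.card : ℝ) ≤ 4 * ((hammingThickening A 1).card - A.card) := by
        by_contra hcon
        push Not at hcon
        nlinarith [mul_lt_mul_of_pos_right hcon hq']
      rw [pow_succ]
      linarith
    · have h1 : (2 : ℝ) ^ (3 * q) ≤ A.card := by exact_mod_cast (not_le.1 hA).le
      have h2 : (A.card : ℝ) ≤ (hammingThickening A 1).card := by
        exact_mod_cast Finset.card_le_card (subset_hammingThickening A 1)
      calc (5 / 4 : ℝ) ^ (r + 1) * B.card ≤ 2 ^ q * 2 ^ (2 * q) := by gcongr
        _ = 2 ^ (3 * q) := by rw [← pow_add]; congr 1; ring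
        _ ≤ _ := h1.trans (h2.trans hsub)

/-! ### Expansion of affine subspaces -/

/-- A subspace `V` of codimension at least `m` has `m` coordinates such that no nonzero vector of
`V` is supported on them. -/
theorem exists_coordinates_disjoint {n m : ℕ} (V : Submodule (ZMod 2) (Fin n → ZMod 2))
    (hV : m + Module.finrank (ZMod 2) V ≤ n) :
    ∃ J : Finset (Fin n), J.card = m ∧
      ∀ v ∈ V, (∀ i ∉ J, v i = 0) → v = 0 := by
  classical
  set Q := (Fin n → ZMod 2) ⧸ V
  set e : Fin n → Q := fun i => V.mkQ (Pi.single i 1)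
  have hspan : Submodule.span (ZMod 2) (Set.range e) = ⊤ := by
    have : Set.range e = V.mkQ '' Set.range (Pi.basisFun (ZMod 2) (Fin n)) := by
      rw [← Set.range_comp]; congr 1; ext i; simp [e]
    rw [this, ← Submodule.map_span, Module.Basis.span_eq, Submodule.map_top, Submodule.range_mkQ]
  obtain ⟨κ, a, ha, hs, hli⟩ := exists_linearIndependent' (ZMod 2) e
  have : Finite κ := Finite.of_injective a ha
  have := Fintype.ofFinite κ
  have hcard : Fintype.card κ = Module.finrank (ZMod 2) Q := by
    rw [← finrank_span_eq_card hli, hs, hspan, finrank_top]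
  have hm : m ≤ (Finset.univ.image a).card := by
    rw [Finset.card_image_of_injective _ ha, Finset.card_univ, hcard]
    have := V.finrank_quotient_add_finrank
    rw [Module.finrank_fin_fun] at this
    exact Nat.add_le_add_iff_right.1 (hV.trans this.ge)
  obtain ⟨J, hJ, hJc⟩ := Finset.exists_subset_card_eq hm
  refine ⟨J, hJc, fun v hv hvJ => ?_⟩
  have hsum : ∑ k, v (a k) • e (a k) = 0 := by
    have h1 : V.mkQ v = ∑ i, v i • e i := by
      conv_lhs => rw [← Finset.univ_sum_single v, map_sum]
      refine Finset.sum_congr rfl fun i _ => ?_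
      rw [← map_smul]; congr 1; rw [← Pi.single_smul]; simp
    have h2 : V.mkQ v = 0 := by simpa using hv
    rw [← h2, h1, ← Finset.sum_image (f := fun i => v i • e i) (g := a) (fun x _ y _ h => ha h)]
    refine Finset.sum_subset (Finset.subset_univ _) fun i _ hi => ?_
    rw [hvJ i fun h => hi (hJ h), zero_smul]
  have hz := Fintype.linearIndependent_iff.1 hli (fun k => v (a k)) hsum
  ext i
  by_cases hi : i ∈ J
  · obtain ⟨k, _, rfl⟩ := Finset.mem_image.1 (hJ hi)
    exact hz k
  · exact hvJ i hi

/-- The `r`-thickening of a small affine subspace contains `choose (2 q) r` disjoint translates of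
it, one for each `r`-subset of a set of coordinates supporting no nonzero direction vector. -/
theorem choose_mul_card_le_card_hammingThickening {q r : ℕ} (B : Finset (Fin (4 * q) → ZMod 2))
    (V : Submodule (ZMod 2) (Fin (4 * q) → ZMod 2)) (b₀ : Fin (4 * q) → ZMod 2)
    (hBV : ∀ b, b ∈ B ↔ b - b₀ ∈ V) (hB : B.card ≤ 2 ^ (2 * q)) :
    (2 * q).choose r * B.card ≤ (hammingThickening B r).card := by
  classical
  have hcard : B.card = 2 ^ Module.finrank (ZMod 2) V := by
    have h1 : Nat.card V = 2 ^ Module.finrank (ZMod 2) V := by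
      rw [Module.natCard_eq_pow_finrank (K := ZMod 2) (V := V)]; simp
    rw [← h1, ← Nat.card_eq_finsetCard B]
    exact Nat.card_congr
      { toFun := fun b => ⟨b.1 - b₀, (hBV _).1 b.2⟩
        invFun := fun v => ⟨v.1 + b₀, (hBV _).2 (by simp)⟩
        left_inv := fun b => by simp
        right_inv := fun v => by simp }
  have hfr : Module.finrank (ZMod 2) V ≤ 2 * q := by
    rw [hcard] at hB
    exact (Nat.pow_le_pow_iff_right (by norm_num)).1 hB
  obtain ⟨J, hJ, hJV⟩ := exists_coordinates_disjoint (m := 2 * q) V (by omega)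
  set χ : Finset (Fin (4 * q)) → Fin (4 * q) → ZMod 2 := fun S i => if i ∈ S then 1 else 0
  rw [← hJ, ← Finset.card_powersetCard, ← Finset.card_product]
  refine Finset.card_le_card_of_injOn (fun e => e.2 + χ e.1) ?_ ?_
  · rintro ⟨S, b⟩ h
    simp only [Finset.coe_product, Set.mem_prod, Finset.mem_coe, Finset.mem_powersetCard] at h
    refine mem_hammingThickening.2 ⟨b, h.2, ?_⟩
    rw [← h.1.2]
    refine Finset.card_le_card fun i hi => ?_
    by_contra hiS
    exact (Finset.mem_filter.1 hi).2 (by simp [χ, hiS])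
  · rintro ⟨S, b⟩ h ⟨T, b'⟩ h' heq
    simp only [Finset.coe_product, Set.mem_prod, Finset.mem_coe, Finset.mem_powersetCard] at h h'
    simp only at heq
    have hv : χ S - χ T = 0 := by
      refine hJV _ ?_ ?_
      · have : χ S - χ T = (b' - b₀) - (b - b₀) := by
          rw [sub_sub_sub_cancel_right, sub_eq_sub_iff_add_eq_add, add_comm, heq]
        rw [this]
        exact V.sub_mem ((hBV _).1 h'.2) ((hBV _).1 h.2)
      · intro i hi
        have h1 : i ∉ S := fun hS => hi (h.1.1 hS)
        have h2 : i ∉ T := fun hT => hi (h'.1.1 hT)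
        simp [χ, h1, h2]
    have hST : S = T := by
      ext i
      have := congrFun (sub_eq_zero.1 hv) i
      by_cases h1 : i ∈ S <;> by_cases h2 : i ∈ T <;> simp_all [χ]
    subst hST
    rw [add_right_cancel heq]

/-! ### The counting argument over consecutive windows -/

/-- The words that codewords show on the window `[t, t + N)`, among codewords that start with the
`t`-prefix `p` and belong to messages that start with `u`. -/
noncomputable def windowWords (C : (ℕ → ZMod 2) → (ℕ → ZMod 2)) {t i : ℕ} (N : ℕ)
    (p : Fin t → ZMod 2) (u : Fin i → ZMod 2) : Finset (Fin N → ZMod 2) :=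
  open Classical in Finset.univ.filter fun w =>
    ∃ x, initSeg (C x) t = p ∧ initSeg x i = u ∧ (fun a : Fin N => C x (t + a)) = w

/-- The `t`-prefixes of codewords of messages that start with `u`. -/
noncomputable def codePrefixes (C : (ℕ → ZMod 2) → (ℕ → ZMod 2)) {i : ℕ} (t : ℕ)
    (u : Fin i → ZMod 2) : Finset (Fin t → ZMod 2) :=
  open Classical in Finset.univ.filter fun v => ∃ x, initSeg x i = u ∧ initSeg (C x) t = v

/-- At every window `[(M + m) 4q, (M + m + 1) 4q)` with `m < m'`, the part of the message decoded
at the end of the window leaves at most `2 ^ (2 q)` possible code prefixes. -/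
def IsSparse (C : (ℕ → ZMod 2) → (ℕ → ZMod 2)) (q M m' : ℕ) (x : ℕ → ZMod 2) : Prop :=
  ∀ m < m', (codePrefixes C ((M + m + 1) * (4 * q))
    (initSeg x ((M + m + 1) * (4 * q) - q))).card ≤ 2 ^ (2 * q)

/-- The prefixes of length `(M + m) 4q` of codewords of messages sparse at the first `m`
windows. -/
noncomputable def sparsePrefixes (C : (ℕ → ZMod 2) → (ℕ → ZMod 2)) (q M m : ℕ) :
    Finset (Fin ((M + m) * (4 * q)) → ZMod 2) :=
  open Classical in Finset.univ.filter fun p =>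
    ∃ x, IsSparse C q M m x ∧ initSeg (C x) ((M + m) * (4 * q)) = p

theorem hammingDist_initSeg_add_le {x y : ℕ → ZMod 2} {t N : ℕ} (h : initSeg x t = initSeg y t) :
    hammingDist (initSeg x (t + N)) (initSeg y (t + N))
      ≤ hammingDist (fun a : Fin N => x (t + a)) fun a : Fin N => y (t + a) := by
  classical
  refine (Finset.card_le_card (t := Finset.map (Fin.natAddEmb t)
    (Finset.univ.filter fun a : Fin N => x (t + a) ≠ y (t + a))) fun a ha => ?_).trans
      (Finset.card_map _).le
  induction a using Fin.addCases with
  | left a =>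
    have := congrFun h a
    simp only [initSeg] at this
    exact absurd this (by simpa [initSeg] using (Finset.mem_filter.1 ha).2)
  | right a =>
    simpa [initSeg] using (Finset.mem_filter.1 ha).2

theorem card_windowWords_le (C : (ℕ → ZMod 2) → (ℕ → ZMod 2)) {t i : ℕ} (N : ℕ)
    (p : Fin t → ZMod 2) (u : Fin i → ZMod 2) :
    (windowWords C N p u).card ≤ (codePrefixes C (t + N) u).card := by
  refine Finset.card_le_card_of_injOn (fun w => Fin.append p w) ?_ ?_
  · intro w hw
    simp only [windowWords, Finset.coe_filter, Finset.mem_univ, true_and,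
      Set.mem_ofPred_eq] at hw
    obtain ⟨x, hp, hu, hw⟩ := hw
    simp only [codePrefixes, Finset.coe_filter, Finset.mem_univ, true_and,
      Set.mem_ofPred_eq]
    refine ⟨x, hu, ?_⟩
    ext a
    induction a using Fin.addCases with
    | left a => rw [Fin.append_left, ← hp]; rfl
    | right a => rw [Fin.append_right, ← hw]; simp [initSeg]
  · intro w _ w' _ h
    ext a
    simpa using congrFun h (Fin.natAdd t a)

/-- If distinct messages `u` are separated by more than `2 r` at the end of the window, and small
sets of window words grow by a factor `G` when thickened by `r`, then each code prefix `p` has at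
most `2 ^ N / G` continuations coming from messages with few code prefixes: for distinct `u` the
thickenings of the sets of continuations are disjoint. -/
theorem mul_card_continuations_le (C : (ℕ → ZMod 2) → (ℕ → ZMod 2)) {t i N r : ℕ} {L : ℕ} {G : ℝ}
    (hdist : ∀ x y, initSeg x i ≠ initSeg y i →
      2 * r < hammingDist (initSeg (C x) (t + N)) (initSeg (C y) (t + N)))
    (p : Fin t → ZMod 2)
    (hgrow : ∀ u : Fin i → ZMod 2, (windowWords C N p u).card ≤ L →
      G * (windowWords C N p u).card ≤ (hammingThickening (windowWords C N p u) r).card)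
    (hG : 0 ≤ G) (W : Finset (Fin N → ZMod 2))
    (hW : ∀ w ∈ W, ∃ x, initSeg (C x) t = p ∧ (codePrefixes C (t + N) (initSeg x i)).card ≤ L ∧
      (fun a : Fin N => C x (t + a)) = w) :
    G * W.card ≤ 2 ^ N := by
  classical
  set U : Finset (Fin i → ZMod 2) :=
    Finset.univ.filter fun u => (codePrefixes C (t + N) u).card ≤ L
  have hWU : W ⊆ U.biUnion fun u => windowWords C N p u := by
    intro w hw
    obtain ⟨x, hp, hx, hxw⟩ := hW w hw
    refine Finset.mem_biUnion.2 ⟨initSeg x i, by simpa [U] using hx, ?_⟩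
    simp only [windowWords, Finset.mem_filter, Finset.mem_univ, true_and]
    exact ⟨x, hp, rfl, hxw⟩
  have hdisj : (U : Set (Fin i → ZMod 2)).PairwiseDisjoint
      fun u => hammingThickening (windowWords C N p u) r := by
    intro u _ v _ huv
    refine Finset.disjoint_left.2 fun z hz hz' => ?_
    obtain ⟨b, hb, hbz⟩ := mem_hammingThickening.1 hz
    obtain ⟨b', hb', hbz'⟩ := mem_hammingThickening.1 hz'
    simp only [windowWords, Finset.mem_filter, Finset.mem_univ, true_and] at hb hb'
    obtain ⟨x, hxp, rfl, rfl⟩ := hb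
    obtain ⟨y, hyp, rfl, rfl⟩ := hb'
    have h1 := hdist x y huv
    have h2 := hammingDist_initSeg_add_le (N := N) (hxp.trans hyp.symm)
    have h3 := hammingDist_triangle_right (fun a : Fin N => C x (t + a))
      (fun a : Fin N => C y (t + a)) z
    omega
  have hsum : (∑ u ∈ U, (hammingThickening (windowWords C N p u) r).card : ℕ) ≤ 2 ^ N := by
    rw [← Finset.card_biUnion hdisj]
    exact (Finset.card_le_univ _).trans (by simp)
  calc G * W.card ≤ G * ∑ u ∈ U, ((windowWords C N p u).card : ℝ) := by
        gcongr
        exact_mod_cast (Finset.card_le_card hWU).trans Finset.card_biUnion_le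
    _ = ∑ u ∈ U, G * ((windowWords C N p u).card : ℝ) := Finset.mul_sum ..
    _ ≤ ∑ u ∈ U, ((hammingThickening (windowWords C N p u) r).card : ℝ) := by
        refine Finset.sum_le_sum fun u hu => hgrow u ?_
        exact (card_windowWords_le C N p u).trans (Finset.mem_filter.1 hu).2
    _ ≤ 2 ^ N := by exact_mod_cast hsum

/-- One window: the number of sparse prefixes grows at most by the factor `2 ^ (4 q) / G`. -/
theorem mul_card_sparsePrefixes_succ_le (C : (ℕ → ZMod 2) → (ℕ → ZMod 2)) {q M m r : ℕ} {G : ℝ}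
    (hG : 0 ≤ G)
    (hdist : ∀ x y, initSeg x ((M + m + 1) * (4 * q) - q) ≠ initSeg y ((M + m + 1) * (4 * q) - q) →
      2 * r < hammingDist (initSeg (C x) ((M + m + 1) * (4 * q)))
        (initSeg (C y) ((M + m + 1) * (4 * q))))
    (hgrow : ∀ (t i : ℕ) (p : Fin t → ZMod 2) (u : Fin i → ZMod 2),
      (windowWords C (4 * q) p u).card ≤ 2 ^ (2 * q) →
      G * (windowWords C (4 * q) p u).card
        ≤ (hammingThickening (windowWords C (4 * q) p u) r).card) :
    G * (sparsePrefixes C q M (m + 1)).card ≤ 2 ^ (4 * q) * (sparsePrefixes C q M m).card := by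
  classical
  set t := (M + m) * (4 * q)
  have ht : (M + m + 1) * (4 * q) = t + 4 * q := by simp only [t]; ring
  have ht' : (M + (m + 1)) * (4 * q) = t + 4 * q := by simp only [t]; ring
  rw [ht] at hdist
  -- The continuations of `p` by one window, among sparse messages.
  set W : (Fin t → ZMod 2) → Finset (Fin (4 * q) → ZMod 2) := fun p =>
    Finset.univ.filter fun w => ∃ x, IsSparse C q M (m + 1) x ∧ initSeg (C x) t = p ∧
      (fun a : Fin (4 * q) => C x (t + a)) = w
  have hWle : ∀ p, G * (W p).card ≤ 2 ^ (4 * q) := by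
    intro p
    refine mul_card_continuations_le C hdist p (fun u hu => hgrow t _ p u hu) hG (W p) ?_
    intro w hw
    obtain ⟨x, hx, hp, hxw⟩ := (Finset.mem_filter.1 hw).2
    refine ⟨x, hp, ?_, hxw⟩
    have := hx m (Nat.lt_succ_self m)
    rwa [ht] at this
  have hcard : (sparsePrefixes C q M (m + 1)).card
      ≤ ((sparsePrefixes C q M m).sigma W).card := by
    refine Finset.card_le_card_of_injOn
      (fun v => ⟨fun a => v (a.castLE (by omega)),
        fun a => v ⟨t + a, by rw [ht']; omega⟩⟩) ?_ ?_
    · intro v hv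
      simp only [sparsePrefixes, Finset.coe_filter, Finset.mem_univ, true_and,
        Set.mem_ofPred_eq] at hv
      obtain ⟨x, hx, rfl⟩ := hv
      simp only [Finset.mem_coe, Finset.mem_sigma, sparsePrefixes, W, Finset.mem_filter,
        Finset.mem_univ, true_and]
      exact ⟨⟨x, fun j hj => hx j (hj.trans (Nat.lt_succ_self m)), rfl⟩, x, hx, rfl, rfl⟩
    · intro v _ w _ h
      simp only [Sigma.mk.injEq, heq_eq_eq] at h
      ext a
      by_cases ha : (a : ℕ) < t
      · exact congrFun h.1 ⟨a, ha⟩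
      · have h2 := congrFun h.2 ⟨a - t, by have := a.2; omega⟩
        have h3 : t + (a - t : ℕ) = a := by omega
        simpa only [h3] using h2
  rw [Finset.card_sigma] at hcard
  calc G * (sparsePrefixes C q M (m + 1)).card
      ≤ G * ∑ p ∈ sparsePrefixes C q M m, ((W p).card : ℝ) := by
        gcongr; exact_mod_cast hcard
    _ = ∑ p ∈ sparsePrefixes C q M m, G * ((W p).card : ℝ) := Finset.mul_sum ..
    _ ≤ ∑ p ∈ sparsePrefixes C q M m, (2 : ℝ) ^ (4 * q) := Finset.sum_le_sum fun p _ => hWle p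
    _ = _ := by rw [Finset.sum_const, nsmul_eq_mul, mul_comm]

/-- The message that starts with `z` and continues with zeros. -/
def zeroExtend {k : ℕ} (z : Fin k → ZMod 2) : ℕ → ZMod 2 :=
  fun a => if h : a < k then z ⟨a, h⟩ else 0

theorem initSeg_zeroExtend {k : ℕ} (z : Fin k → ZMod 2) : initSeg (zeroExtend z) k = z := by
  ext a; simp [initSeg, zeroExtend]

/-- If `i`-prefixes of messages can be decoded from `t`-prefixes of codewords, then few messages
have an `i`-prefix with more than `2 ^ L` code prefixes, since the sets of code prefixes are
disjoint. -/
theorem card_not_sparse_mul_le (C : (ℕ → ZMod 2) → (ℕ → ZMod 2)) {k i t L : ℕ} (hik : i ≤ k)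
    (hdec : ∀ x y, initSeg (C x) t = initSeg (C y) t → initSeg x i = initSeg y i) :
    (Finset.univ.filter fun z : Fin k → ZMod 2 =>
      2 ^ L < (codePrefixes C t (initSeg (zeroExtend z) i)).card).card * 2 ^ L
        ≤ 2 ^ t * 2 ^ (k - i) := by
  classical
  set U : Finset (Fin i → ZMod 2) :=
    Finset.univ.filter fun u => 2 ^ L < (codePrefixes C t u).card
  have hU : U.card * 2 ^ L ≤ 2 ^ t := by
    have hdisj : (U : Set (Fin i → ZMod 2)).PairwiseDisjoint fun u => codePrefixes C t u := by
      intro u _ v _ huv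
      refine Finset.disjoint_left.2 fun z hz hz' => huv ?_
      simp only [codePrefixes, Finset.mem_filter, Finset.mem_univ, true_and] at hz hz'
      obtain ⟨x, rfl, hx⟩ := hz
      obtain ⟨y, rfl, hy⟩ := hz'
      exact hdec x y (hx.trans hy.symm)
    calc U.card * 2 ^ L = ∑ u ∈ U, 2 ^ L := by simp
      _ ≤ ∑ u ∈ U, (codePrefixes C t u).card :=
        Finset.sum_le_sum fun u hu => (Finset.mem_filter.1 hu).2.le
      _ = (U.biUnion fun u => codePrefixes C t u).card := (Finset.card_biUnion hdisj).symm
      _ ≤ 2 ^ t := (Finset.card_le_univ _).trans (by simp)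
  have hz : (Finset.univ.filter fun z : Fin k → ZMod 2 =>
      2 ^ L < (codePrefixes C t (initSeg (zeroExtend z) i)).card).card
        ≤ (U ×ˢ (Finset.univ : Finset (Fin (k - i) → ZMod 2))).card := by
    refine Finset.card_le_card_of_injOn
      (fun z => (initSeg (zeroExtend z) i, fun a => z ⟨i + a, by omega⟩)) ?_ ?_
    · intro z hz
      simp only [Finset.coe_filter, Finset.mem_univ, true_and, Set.mem_ofPred_eq] at hz
      simpa [U] using hz
    · intro z _ z' _ h
      simp only [Prod.mk.injEq] at h
      ext a
      by_cases ha : (a : ℕ) < i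
      · have := congrFun h.1 ⟨a, ha⟩
        simpa [initSeg, zeroExtend] using this
      · have h2 := congrFun h.2 ⟨a - i, by have := a.2; omega⟩
        have h3 : i + (a - i : ℕ) = a := by omega
        simpa only [h3] using h2
  rw [Finset.card_product] at hz
  have hc : (Finset.univ : Finset (Fin (k - i) → ZMod 2)).card = 2 ^ (k - i) := by simp
  rw [hc] at hz
  calc _ ≤ U.card * 2 ^ (k - i) * 2 ^ L := Nat.mul_le_mul_right _ hz
    _ = U.card * 2 ^ L * 2 ^ (k - i) := by ring
    _ ≤ _ := Nat.mul_le_mul_right _ hU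

/-- At least half of all messages of length `8 M q - q` are sparse at all windows. -/
theorem pow_le_two_mul_card_sparse (C : (ℕ → ZMod 2) → (ℕ → ZMod 2)) {q M : ℕ}
    (hM : 2 * M ≤ 2 ^ q)
    (hdec : ∀ t, 4 * M * q ≤ t → t ≤ 8 * M * q → ∀ x y,
      initSeg (C x) t = initSeg (C y) t → initSeg x (t - q) = initSeg y (t - q)) :
    open Classical in 2 ^ (8 * M * q - q) ≤ 2 * (Finset.univ.filter
      fun z : Fin (8 * M * q - q) → ZMod 2 => IsSparse C q M M (zeroExtend z)).card := by
  classical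
  set k := 8 * M * q - q
  set bad : ℕ → Finset (Fin k → ZMod 2) := fun m => Finset.univ.filter fun z =>
    2 ^ (2 * q) < (codePrefixes C ((M + m + 1) * (4 * q))
      (initSeg (zeroExtend z) ((M + m + 1) * (4 * q) - q))).card
  have hbad : ∀ m ∈ Finset.range M, (bad m).card * 2 ^ q ≤ 2 ^ k := by
    intro m hm
    have hm : m < M := Finset.mem_range.1 hm
    set t := (M + m + 1) * (4 * q)
    have h1 : 4 * M * q ≤ t := by simp only [t]; nlinarith
    have h2 : t ≤ 8 * M * q := by
      have : (M + m + 1) * (4 * q) ≤ (2 * M) * (4 * q) := Nat.mul_le_mul_right _ (by omega)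
      calc t ≤ _ := this
        _ = _ := by ring
    have hqt : 4 * q ≤ t := Nat.le_mul_of_pos_left _ (by omega)
    have h := card_not_sparse_mul_le C (k := k) (i := t - q) (t := t) (L := 2 * q)
      (by omega) (hdec t h1 h2)
    have h3 : 2 ^ t * 2 ^ (k - (t - q)) = 2 ^ k * 2 ^ q := by
      rw [← pow_add, ← pow_add]; congr 1; omega
    have h4 : (bad m).card * 2 ^ (2 * q) ≤ 2 ^ k * 2 ^ q := h3 ▸ h
    rw [two_mul q, pow_add, ← mul_assoc] at h4
    exact Nat.le_of_mul_le_mul_right h4 (by positivity)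
  have hcover : (Finset.univ : Finset (Fin k → ZMod 2)) ⊆
      (Finset.univ.filter fun z => IsSparse C q M M (zeroExtend z)) ∪
        (Finset.range M).biUnion bad := by
    intro z _
    by_cases hz : IsSparse C q M M (zeroExtend z)
    · exact Finset.mem_union_left _ (by simpa using hz)
    · refine Finset.mem_union_right _ ?_
      simp only [IsSparse, not_forall, not_le] at hz
      obtain ⟨m, hm, hz⟩ := hz
      exact Finset.mem_biUnion.2 ⟨m, Finset.mem_range.2 hm, by simpa [bad] using hz⟩
  have hcard := (Finset.card_le_card hcover).trans (Finset.card_union_le _ _)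
  have hb : ((Finset.range M).biUnion bad).card * 2 ^ q ≤ M * 2 ^ k := by
    calc _ ≤ (∑ m ∈ Finset.range M, (bad m).card) * 2 ^ q :=
          Nat.mul_le_mul_right _ Finset.card_biUnion_le
      _ = ∑ m ∈ Finset.range M, (bad m).card * 2 ^ q := Finset.sum_mul ..
      _ ≤ ∑ m ∈ Finset.range M, 2 ^ k := Finset.sum_le_sum hbad
      _ = M * 2 ^ k := by simp
  have hb2 : 2 * ((Finset.range M).biUnion bad).card ≤ 2 ^ k := by
    refine Nat.le_of_mul_le_mul_right (c := 2 ^ q) ?_ (by positivity)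
    calc 2 * ((Finset.range M).biUnion bad).card * 2 ^ q ≤ 2 * (M * 2 ^ k) := by
          rw [mul_assoc]; exact Nat.mul_le_mul_left 2 hb
      _ = 2 * M * 2 ^ k := by ring
      _ ≤ 2 ^ q * 2 ^ k := Nat.mul_le_mul_right _ hM
      _ = _ := by ring
  have hk : (Finset.univ : Finset (Fin k → ZMod 2)).card = 2 ^ k := by simp
  rw [hk] at hcard
  omega

/-- The main count. Over the `M` windows the sparse prefixes lose a factor `G ^ M` against all
words of length `8 M q`, yet half of the `2 ^ (8 M q - q)` messages have distinct ones. -/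
theorem pow_le_of_growth (C : (ℕ → ZMod 2) → (ℕ → ZMod 2)) {q M r : ℕ} {G : ℝ} (hG : 0 ≤ G)
    (hM1 : 1 ≤ M) (hM : 2 * M ≤ 2 ^ q)
    (hdist : ∀ t, 4 * M * q ≤ t → t ≤ 8 * M * q → ∀ x y,
      initSeg x (t - q) ≠ initSeg y (t - q) →
        2 * r < hammingDist (initSeg (C x) t) (initSeg (C y) t))
    (hgrow : ∀ (t i : ℕ) (p : Fin t → ZMod 2) (u : Fin i → ZMod 2),
      (windowWords C (4 * q) p u).card ≤ 2 ^ (2 * q) →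
      G * (windowWords C (4 * q) p u).card
        ≤ (hammingThickening (windowWords C (4 * q) p u) r).card) :
    G ^ M ≤ 2 ^ (q + 1) := by
  classical
  have hdec : ∀ t, 4 * M * q ≤ t → t ≤ 8 * M * q → ∀ x y,
      initSeg (C x) t = initSeg (C y) t → initSeg x (t - q) = initSeg y (t - q) := by
    intro t h1 h2 x y h
    by_contra hne
    have := hdist t h1 h2 x y hne
    rw [h, hammingDist_self] at this
    omega
  have hstep : ∀ m ≤ M, G ^ m * (sparsePrefixes C q M m).card ≤ 2 ^ ((M + m) * (4 * q)) := by
    intro m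
    induction m with
    | zero =>
      intro _
      have : (sparsePrefixes C q M 0).card ≤ 2 ^ ((M + 0) * (4 * q)) :=
        (Finset.card_le_univ _).trans (by simp)
      simpa using (by exact_mod_cast this :
        ((sparsePrefixes C q M 0).card : ℝ) ≤ 2 ^ ((M + 0) * (4 * q)))
    | succ m ih =>
      intro hm
      have h1 : 4 * M * q ≤ (M + m + 1) * (4 * q) := by nlinarith
      have h2 : (M + m + 1) * (4 * q) ≤ 8 * M * q := by
        have : (M + m + 1) * (4 * q) ≤ (2 * M) * (4 * q) := Nat.mul_le_mul_right _ (by omega)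
        linarith
      have h := mul_card_sparsePrefixes_succ_le C hG (hdist _ h1 h2) hgrow
      calc G ^ (m + 1) * ((sparsePrefixes C q M (m + 1)).card : ℝ)
          = G ^ m * (G * (sparsePrefixes C q M (m + 1)).card) := by ring
        _ ≤ G ^ m * (2 ^ (4 * q) * (sparsePrefixes C q M m).card) := by gcongr
        _ = 2 ^ (4 * q) * (G ^ m * (sparsePrefixes C q M m).card) := by ring
        _ ≤ 2 ^ (4 * q) * 2 ^ ((M + m) * (4 * q)) := by gcongr; exact ih (by omega)
        _ = 2 ^ ((M + (m + 1)) * (4 * q)) := by rw [← pow_add]; congr 1; ring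
  have hMM : (M + M) * (4 * q) = 8 * M * q := by ring
  have hlast : G ^ M * (sparsePrefixes C q M M).card ≤ 2 ^ (8 * M * q) :=
    (hstep M le_rfl).trans_eq (congrArg _ hMM)
  have hinj : (Finset.univ.filter fun z : Fin (8 * M * q - q) → ZMod 2 =>
      IsSparse C q M M (zeroExtend z)).card ≤ (sparsePrefixes C q M M).card := by
    refine Finset.card_le_card_of_injOn
      (fun z => initSeg (C (zeroExtend z)) ((M + M) * (4 * q))) ?_ ?_
    · intro z hz
      simp only [Finset.coe_filter, Finset.mem_univ, true_and, Set.mem_ofPred_eq] at hz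
      simp only [sparsePrefixes, Finset.coe_filter, Finset.mem_univ, true_and,
        Set.mem_ofPred_eq]
      exact ⟨_, hz, rfl⟩
    · intro z _ z' _ h
      have := hdec ((M + M) * (4 * q)) (by nlinarith) hMM.le _ _ h
      rw [hMM, initSeg_zeroExtend, initSeg_zeroExtend] at this
      exact this
  have hhalf := (pow_le_two_mul_card_sparse C hM hdec).trans (Nat.mul_le_mul_left 2 hinj)
  have hhalf' : (2 : ℝ) ^ (8 * M * q - q) ≤ 2 * (sparsePrefixes C q M M).card := by
    exact_mod_cast hhalf
  have hq : q ≤ 8 * M * q := by nlinarith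
  have hpow : (2 : ℝ) ^ (8 * M * q) = 2 ^ (8 * M * q - q) * 2 ^ q := by
    rw [← pow_add]; congr 1; omega
  refine le_of_mul_le_mul_left (a := (2 : ℝ) ^ (8 * M * q - q)) ?_ (by positivity)
  calc (2 : ℝ) ^ (8 * M * q - q) * G ^ M
      ≤ 2 * (sparsePrefixes C q M M).card * G ^ M := by gcongr
    _ = 2 * (G ^ M * (sparsePrefixes C q M M).card) := by ring
    _ ≤ 2 * 2 ^ (8 * M * q) := by gcongr
    _ = 2 ^ (8 * M * q - q) * 2 ^ (q + 1) := by rw [hpow]; ring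

/-! ### From growth factors to bounds on the rate -/

/-- The distance of an unbounded code is at most `1`. -/
theorem IsUnboundedCode.le_one {R ε : ℝ} {C : (ℕ → ZMod 2) → (ℕ → ZMod 2)}
    (hC : IsUnboundedCode R ε C) : ε ≤ 1 := by
  obtain ⟨k₀, hk⟩ := hC
  obtain ⟨j, hj⟩ := exists_nat_ge (max 1 (((k₀ + 1 : ℕ) : ℝ) / R))
  have hj1 : (1 : ℝ) ≤ j := (le_max_left _ _).trans hj
  have h := hk 0 1 (k₀ + 1) j (Nat.le_succ _) ((le_max_right _ _).trans hj) fun h => by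
    simpa [initSeg] using congrFun h 0
  have h2 : (hammingDist (initSeg (C 0) j) (initSeg (C 1) j) : ℝ) ≤ j := by
    exact_mod_cast hammingDist_le_card_fintype.trans (by simp)
  nlinarith

/-- An unbounded code of rate at least `1 - 1 / (8 M)` cannot have window words that grow by a
factor `G ≥ 4 ^ s` for every `a` units of radius, if `a < 2 ε s M ^ 2`. The window length is
`4 s M n` and the radius `a n` for a large integer `n`. -/
theorem IsUnboundedCode.false_of_growth {R ε : ℝ} {C : (ℕ → ZMod 2) → (ℕ → ZMod 2)}
    (hC : IsUnboundedCode R ε C) (hR : 0 < R) (hε : 0 < ε) {M s a : ℕ} {G : ℝ}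
    (hM : 1 ≤ M) (hs : 1 ≤ s) (hRM : 1 - 1 / (8 * M) ≤ R) (ha : (a : ℝ) < 2 * ε * s * M ^ 2)
    (hG : 4 ^ s ≤ G)
    (hgrow : ∀ n : ℕ, 0 < n → ∀ (t i : ℕ) (p : Fin t → ZMod 2) (u : Fin i → ZMod 2),
      (windowWords C (4 * (s * M * n)) p u).card ≤ 2 ^ (2 * (s * M * n)) →
      G ^ n * (windowWords C (4 * (s * M * n)) p u).card
        ≤ (hammingThickening (windowWords C (4 * (s * M * n)) p u) (a * n)).card) : False := by
  obtain ⟨k₀, hk⟩ := hC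
  obtain ⟨n, hn⟩ : ∃ n, n = k₀ + 2 * M + 2 := ⟨_, rfl⟩
  obtain ⟨q, hq⟩ : ∃ q, q = s * M * n := ⟨_, rfl⟩
  have hnq : n ≤ q := hq ▸ Nat.le_mul_of_pos_left n (Nat.mul_pos hs hM)
  have hMR : (0 : ℝ) < M := by exact_mod_cast hM
  have hGpos : 0 < G := lt_of_lt_of_le (by positivity) hG
  have hMq : 2 * M ≤ 2 ^ q := (show 2 * M ≤ q by omega).trans Nat.lt_two_pow_self.le
  have hdist : ∀ t, 4 * M * q ≤ t → t ≤ 8 * M * q → ∀ x y,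
      initSeg x (t - q) ≠ initSeg y (t - q) →
        2 * (a * n) < hammingDist (initSeg (C x) t) (initSeg (C y) t) := by
    intro t h1 h2 x y hxy
    have hqt : 4 * q ≤ t := le_trans (by nlinarith) h1
    have h1' : (4 * M * q : ℝ) ≤ t := by exact_mod_cast h1
    have h2' : (t : ℝ) ≤ 8 * M * q := by exact_mod_cast h2
    have hrate : ((t - q : ℕ) : ℝ) / R ≤ t := by
      rw [div_le_iff₀ hR, Nat.cast_sub (by omega)]
      have h3 : (t : ℝ) * (1 / (8 * M)) ≤ q := by
        rw [mul_one_div, div_le_iff₀ (by positivity)]; linarith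
      have h4 := mul_le_mul_of_nonneg_left hRM (Nat.cast_nonneg (α := ℝ) t)
      linarith
    have h := hk x y (t - q) t (by omega) hrate hxy
    have h5 : (2 * (a * n) : ℝ) < ε * t := by
      have hnR : (0 : ℝ) < n := by exact_mod_cast (by omega : 0 < n)
      calc (2 * (a * n) : ℝ) = 2 * a * n := by ring
        _ < 2 * (2 * ε * s * M ^ 2) * n := by gcongr
        _ = ε * (4 * M * q) := by rw [hq]; push_cast; ring
        _ ≤ ε * t := by gcongr
    exact_mod_cast h5.trans_le h
  have h := pow_le_of_growth C (r := a * n) (G := G ^ n) (by positivity) hM hMq hdist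
    (hq ▸ hgrow n (by omega))
  have h4 : (4 : ℝ) ^ q ≤ (G ^ n) ^ M := by
    calc (4 : ℝ) ^ q = ((4 ^ s) ^ n) ^ M := by
          rw [hq, ← pow_mul, ← pow_mul]; congr 1; ring
      _ ≤ (G ^ n) ^ M := by gcongr
  have h5 : (2 : ℝ) ^ (q + 1) < 4 ^ q := by
    have : (4 : ℝ) = 2 ^ 2 := by norm_num
    rw [this, ← pow_mul]
    exact pow_lt_pow_right₀ one_lt_two (by omega)
  linarith

/-- The rate bound for arbitrary codes, from the `5 / 4` growth of sets in the cube. -/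
theorem IsUnboundedCode.rate_le {R ε : ℝ} {C : (ℕ → ZMod 2) → (ℕ → ZMod 2)}
    (hR : 0 < R) (hε : 0 < ε) (hC : IsUnboundedCode R ε C) :
    R ≤ 1 - 1 / 40 * Real.sqrt ε := by
  by_contra hcon
  push Not at hcon
  have hε1 : Real.sqrt ε ≤ 1 := Real.sqrt_le_one.2 hC.le_one
  have hσ : 0 < Real.sqrt ε := Real.sqrt_pos.2 hε
  set σ := Real.sqrt ε
  have hσ2 : σ ^ 2 = ε := Real.sq_sqrt hε.le
  obtain ⟨M, hMdef⟩ : ∃ M, M = ⌈4 / σ⌉₊ := ⟨_, rfl⟩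
  have hM : 4 / σ ≤ M := hMdef ▸ Nat.le_ceil _
  have hM' : (M : ℝ) < 4 / σ + 1 := hMdef ▸ Nat.ceil_lt_add_one (by positivity)
  have hMσ : 4 ≤ M * σ := (div_le_iff₀ hσ).1 hM
  have hMσ' : M * σ ≤ 5 := by
    have : (4 / σ + 1) * σ = 4 + σ := by field_simp
    nlinarith
  have hM4 : 4 ≤ M := by
    have : (4 : ℝ) ≤ M := by nlinarith [Nat.cast_nonneg (α := ℝ) M]
    exact_mod_cast this
  have hM0 : (0 : ℝ) < M := by exact_mod_cast (by omega : 0 < M)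
  refine hC.false_of_growth hR hε (M := M) (s := 1) (a := 8) (G := (5 / 4) ^ 8) (by omega) le_rfl
    ?_ ?_ (by norm_num) ?_
  · have : 1 / 40 * σ ≤ 1 / (8 * M) := by
      rw [le_div_iff₀ (by positivity)]; linarith
    linarith
  · have : (M : ℝ) ^ 2 * ε = (M * σ) ^ 2 := by rw [← hσ2]; ring
    push_cast
    nlinarith
  · intro n hn t i p u hB
    rw [← pow_mul]
    have hq : 0 < 1 * M * n := Nat.mul_pos (by omega) hn
    refine pow_mul_card_le_card_hammingThickening hq ?_ _ hB
    rw [pow_mul, one_mul, pow_mul]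
    refine pow_le_pow_left₀ (by positivity) ?_ n
    exact (by norm_num : (5 / 4 : ℝ) ^ 8 ≤ 2 ^ 4).trans (pow_le_pow_right₀ one_le_two hM4)

/-- For a linear code the sets of window words are affine subspaces. -/
theorem exists_submodule_windowWords {C : (ℕ → ZMod 2) → (ℕ → ZMod 2)}
    (hC : IsLinearMap (ZMod 2) C) {t i N : ℕ} (p : Fin t → ZMod 2) (u : Fin i → ZMod 2)
    {b₀ : Fin N → ZMod 2} (hb₀ : b₀ ∈ windowWords C N p u) :
    ∃ V : Submodule (ZMod 2) (Fin N → ZMod 2), ∀ b, b ∈ windowWords C N p u ↔ b - b₀ ∈ V := by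
  simp only [windowWords, Finset.mem_filter, Finset.mem_univ, true_and] at hb₀ ⊢
  obtain ⟨x₀, rfl, rfl, rfl⟩ := hb₀
  refine ⟨
    { carrier := {w | ∃ x, initSeg (C x) t = 0 ∧ initSeg x i = 0 ∧
        (fun a : Fin N => C x (t + a)) = w}
      zero_mem' := ⟨0, by rw [hC.map_zero]; rfl, rfl, by rw [hC.map_zero]; rfl⟩
      add_mem' := ?_
      smul_mem' := ?_ }, fun b => ⟨?_, ?_⟩⟩
  · rintro _ _ ⟨x, h1, h2, rfl⟩ ⟨y, h3, h4, rfl⟩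
    refine ⟨x + y, ?_, ?_, ?_⟩
    · rw [hC.map_add]; exact (congrArg₂ (· + ·) h1 h3).trans (add_zero 0)
    · exact (congrArg₂ (· + ·) h2 h4).trans (add_zero 0)
    · rw [hC.map_add]; rfl
  · rintro c _ ⟨x, h1, h2, rfl⟩
    refine ⟨c • x, ?_, ?_, ?_⟩
    · rw [hC.map_smul]; exact (congrArg (c • ·) h1).trans (smul_zero c)
    · exact (congrArg (c • ·) h2).trans (smul_zero c)
    · rw [hC.map_smul]; rfl
  · rintro ⟨x, h1, h2, rfl⟩
    refine ⟨x - x₀, ?_, ?_, ?_⟩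
    · rw [hC.map_sub]; exact (congrArg (· - initSeg (C x₀) t) h1).trans (sub_self _)
    · exact (congrArg (· - initSeg x₀ i) h2).trans (sub_self _)
    · rw [hC.map_sub]; rfl
  · rintro ⟨x, h1, h2, h3⟩
    refine ⟨x + x₀, ?_, ?_, ?_⟩
    · rw [hC.map_add]; exact (congrArg (· + initSeg (C x₀) t) h1).trans (zero_add _)
    · exact (congrArg (· + initSeg x₀ i) h2).trans (zero_add _)
    · rw [hC.map_add]; exact (congrArg (· + fun a : Fin N => C x₀ (t + a)) h3).trans
        (sub_add_cancel _ _)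

theorem pow_le_choose_two_mul (K n : ℕ) (hK : 1 ≤ K) :
    (K : ℝ) ^ n ≤ (2 * (K * n)).choose n := by
  have hKn : n ≤ K * n := Nat.le_mul_of_pos_left n hK
  have h := Nat.pow_le_choose (α := ℝ) n (2 * (K * n))
  refine le_trans ?_ h
  rw [le_div_iff₀ (by positivity)]
  have hf : K ^ n * n.factorial ≤ (2 * (K * n) + 1 - n) ^ n := by
    calc K ^ n * n.factorial ≤ K ^ n * n ^ n := Nat.mul_le_mul_left _ n.factorial_le_pow
      _ = (K * n) ^ n := (mul_pow K n n).symm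
      _ ≤ _ := Nat.pow_le_pow_left (by omega) n
  exact_mod_cast hf

/-- The rate bound for linear codes and small distances, from the growth of affine subspaces. -/
theorem IsUnboundedCode.rate_le_of_isLinearMap {R ε : ℝ} {C : (ℕ → ZMod 2) → (ℕ → ZMod 2)}
    (hR : 0 < R) (hε : 0 < ε) (hε16 : ε ≤ 1 / 16) (hC : IsUnboundedCode R ε C)
    (hlin : IsLinearMap (ZMod 2) C) :
    R ≤ 1 - 1 / 48 * Real.sqrt (ε * Real.logb 2 (1 / ε)) := by
  by_contra hcon
  push Not at hcon
  have hinv : (16 : ℝ) ≤ 1 / ε := by rw [le_div_iff₀ hε]; linarith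
  obtain ⟨l, hl⟩ : ∃ l, l = Real.logb 2 (1 / ε) := ⟨_, rfl⟩
  rw [← hl] at hcon
  have hl4 : 4 ≤ l := by
    rw [hl, Real.le_logb_iff_rpow_le one_lt_two (by positivity)]
    exact le_trans (by norm_num) hinv
  obtain ⟨s, hsdef⟩ : ∃ s, s = ⌊l / 4⌋₊ := ⟨_, rfl⟩
  have hsl : (s : ℝ) ≤ l / 4 := hsdef ▸ Nat.floor_le (by positivity)
  have hs1 : 1 ≤ s := hsdef ▸ Nat.le_floor (by push_cast; linarith)
  have hls : l / 4 < s + 1 := hsdef ▸ Nat.lt_floor_add_one _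
  have hs1' : (1 : ℝ) ≤ s := by exact_mod_cast hs1
  have h16 : (16 : ℝ) ^ s ≤ 1 / ε := by
    calc (16 : ℝ) ^ s = (2 : ℝ) ^ ((4 * s : ℕ) : ℝ) := by
          rw [Real.rpow_natCast, pow_mul]; norm_num
      _ ≤ (2 : ℝ) ^ l := Real.rpow_le_rpow_of_exponent_le one_le_two (by push_cast; linarith)
      _ = 1 / ε := by rw [hl, Real.rpow_logb two_pos (by norm_num) (by positivity)]
  have h16' : (16 : ℝ) ^ s * ε ≤ 1 := (le_div_iff₀ hε).1 h16
  have hεs : ε * s ≤ 1 := by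
    have : (s : ℝ) ≤ 16 ^ s := by exact_mod_cast (Nat.lt_pow_self (by norm_num)).le
    nlinarith
  have hσ : 0 < Real.sqrt (ε * s) := Real.sqrt_pos.2 (by positivity)
  have hσ1 : Real.sqrt (ε * s) ≤ 1 := Real.sqrt_le_one.2 hεs
  have hσl : Real.sqrt (ε * l) ≤ 3 * Real.sqrt (ε * s) := by
    have h9 : Real.sqrt (9 * (ε * s)) = 3 * Real.sqrt (ε * s) := by
      rw [Real.sqrt_mul (by norm_num), show (9 : ℝ) = 3 ^ 2 by norm_num,
        Real.sqrt_sq (by norm_num)]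
    rw [← h9]
    exact Real.sqrt_le_sqrt (by nlinarith)
  have hσ2 : Real.sqrt (ε * s) ^ 2 = ε * s := Real.sq_sqrt (by positivity)
  set σ := Real.sqrt (ε * s)
  obtain ⟨M, hMdef⟩ : ∃ M, M = ⌈1 / σ⌉₊ := ⟨_, rfl⟩
  have hM : 1 / σ ≤ M := hMdef ▸ Nat.le_ceil _
  have hM' : (M : ℝ) < 1 / σ + 1 := hMdef ▸ Nat.ceil_lt_add_one (by positivity)
  have hMσ : 1 ≤ M * σ := (div_le_iff₀ hσ).1 hM
  have hMσ' : M * σ ≤ 2 := by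
    have : (1 / σ + 1) * σ = 1 + σ := by field_simp
    nlinarith
  have hM1 : 1 ≤ M := by
    have : (1 : ℝ) ≤ M := by nlinarith [Nat.cast_nonneg (α := ℝ) M]
    exact_mod_cast this
  have hM0 : (0 : ℝ) < M := by exact_mod_cast hM1
  have hMsq : 1 ≤ ε * s * M ^ 2 := by
    rw [← hσ2, ← mul_pow, mul_comm]; exact one_le_pow₀ hMσ
  refine hC.false_of_growth hR hε (M := M) (s := s) (a := 1) (G := (s * M : ℕ)) hM1 hs1
    ?_ ?_ ?_ ?_
  · have : 1 / 48 * Real.sqrt (ε * l) ≤ 1 / (8 * M) := by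
      rw [le_div_iff₀ (by positivity)]
      nlinarith
    linarith
  · push_cast; linarith
  · -- Squared and multiplied by `ε`, the claim is `16 ^ s ε ≤ (s M) ^ 2 ε`, and `1` separates them.
    push_cast
    refine (sq_le_sq₀ (by positivity) (by positivity)).1 ?_
    have h1 : ((4 : ℝ) ^ s) ^ 2 = 16 ^ s := by
      rw [← pow_mul, mul_comm, pow_mul]; norm_num
    rw [h1]
    refine le_of_mul_le_mul_right ?_ hε
    calc (16 : ℝ) ^ s * ε ≤ 1 := h16'
      _ ≤ ε * s * M ^ 2 := hMsq
      _ ≤ s * (ε * s * M ^ 2) := le_mul_of_one_le_left (by positivity) hs1'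
      _ = (s * M) ^ 2 * ε := by ring
  · intro n hn t i p u hB
    rcases (windowWords C (4 * (s * M * n)) p u).eq_empty_or_nonempty with h0 | ⟨b₀, hb₀⟩
    · simp [h0]
    obtain ⟨V, hV⟩ := exists_submodule_windowWords hlin p u hb₀
    have h := choose_mul_card_le_card_hammingThickening (r := 1 * n) _ V b₀ hV hB
    have hK := pow_le_choose_two_mul (s * M) n (Nat.mul_pos hs1 hM1)
    calc _ ≤ ((2 * (s * M * n)).choose n : ℝ) * (windowWords C (4 * (s * M * n)) p u).card := by
          gcongr
      _ ≤ _ := by rw [one_mul] at h ⊢; exact_mod_cast h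

theorem mainTheorem1 :
    (∃ c : ℝ, 0 < c ∧
      ∀ (R ε : ℝ) (C : (ℕ → ZMod 2) → (ℕ → ZMod 2)), 0 < R → 0 < ε →
        IsUnboundedCode R ε C →
          R ≤ 1 - c * Real.sqrt ε) ∧
    (∃ c : ℝ, 0 < c ∧
      ∀ (R ε : ℝ) (C : (ℕ → ZMod 2) → (ℕ → ZMod 2)), 0 < R → 0 < ε → ε < 1 →
        IsUnboundedCode R ε C → IsLinearMap (ZMod 2) C →
          R ≤ 1 - c * Real.sqrt (ε * Real.logb 2 (1 / ε))) := by
  refine ⟨⟨1 / 40, by norm_num, fun R ε C hR hε hC => hC.rate_le hR hε⟩,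
    1 / 80, by norm_num, fun R ε C hR hε _ hC hlin => ?_⟩
  rcases le_total ε (1 / 16) with h | h
  · have h1 := hC.rate_le_of_isLinearMap hR hε h hlin
    have h2 := Real.sqrt_nonneg (ε * Real.logb 2 (1 / ε))
    linarith
  · -- Here `logb 2 (1 / ε) ≤ 4`, so the bound for arbitrary codes is strong enough.
    have h1 := hC.rate_le hR hε
    have hl : Real.logb 2 (1 / ε) ≤ 4 := by
      rw [Real.logb_le_iff_le_rpow one_lt_two (by positivity), div_le_iff₀ hε]
      norm_num
      linarith
    have h2 : Real.sqrt (ε * Real.logb 2 (1 / ε)) ≤ 2 * Real.sqrt ε := by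
      rw [show 2 * Real.sqrt ε = Real.sqrt (ε * 4) by
        rw [Real.sqrt_mul hε.le, show (4 : ℝ) = 2 ^ 2 by norm_num,
          Real.sqrt_sq (by norm_num)]; ring]
      exact Real.sqrt_le_sqrt (by gcongr)
    linarith
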